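/- Let $\mathcal D$ be a square torus of side $a>0$ with its flat distance and Lebesgue measure, let $K$ be a number of orthogonal bands, and let $\mathcal P(K)$ be the set of non-empty subsets of $\{1,\dots,K\}$ (the classes). Fix $\lambda>0$, $r\ge 0$, $\mathcal N_0>0$, a probability vector $(p_C)_{C\in\mathcal P(K)}$, mean file sizes $L_C>0$, and a non-negative non-increasing path-loss function $\ell$ on $[0,\infty)$ with $\ell(0)=1$. A user is a triple $(x,y,C)$ made of a receiver location $x\in\mathcal D$, a transmitter location $y\in\mathcal D$ and a class $C\in\mathcal P(K)$. Consider the spatial birth-and-death Markov jump process $(\Phi_t)_{t\ge0}$ on finite configurations of users with the following dynamics: - transmitters arrive according to a space-time Poisson process of intensity $\lambda\,\mathrm dy\,\mathrm dt$ on $\mathcal D\times[0,\infty)$; independently for each arrival, the receiver is placed at $x=y+r(\cos\theta,\sin\theta)$ with $\theta$ uniform on the circle, and the class is $C$ with probability $p_C$; - each user $u=(x,y,C)$ of the current configuration $\Phi$ leaves at rate $$\frac{1}{L_C}\,R(u,\Phi),\qquad R(u,\Phi)=\frac{|C|\,\ell(r)}{\mathcal N_0+\sum_{(x',y',C')\in\Phi\setminus\{u\}}|C\cap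 C'|\,\ell(\|x-y'\|)}$$ (that is, file sizes in class $C$ are exponential with mean $L_C$ and are served at rate $R$). Suppose that the network is symmetric: $p_C=p_D$ and $L_C=L_D$ whenever $|C|=|D|$. Let $\Phi_0$ be distributed according to a stationary law of this process, that is, an invariant probability measure, and for $C\in\mathcal P(K)$ let $$\mu_C=\frac{1}{|\mathcal D|}\,\mathbb E\big[\Phi_{C,0}(\mathcal D)\big]\in[0,\infty]$$ be the user density of class $C$, where $\Phi_{C,0}(\mathcal D)$ is the number of users of class $C$ in $\Phi_0$. Then $$\forall\, C,D\in\mathcal P(K),\qquad |C|=|D|\ \Longrightarrow\ \mu_C=\mu_D .$$ -/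

import Mathlib

open MeasureTheory Set
open scoped ENNReal

noncomputable section

namespace WirelessSBD

/-- The set `𝒫(K)` of classes: non-empty sets of bands. -/
abbrev BandClass (K : ℕ) : Type := {C : Finset (Fin K) // C.Nonempty}

/-- The finite set of classes carries the discrete σ-algebra. -/
instance (K : ℕ) : MeasurableSpace (BandClass K) := ⊤

/-- The square torus of side `a`. -/
abbrev Torus (a : ℝ) : Type := AddCircle a × AddCircle a

/-- The Euclidean (flat) distance on the square torus. -/
def torusDist {a : ℝ} (x y : Torus a) : ℝ :=
  Real.sqrt (‖x.1 - y.1‖ ^ 2 + ‖x.2 - y.2‖ ^ 2)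

/-- A user: (location of the receiver, location of the transmitter, class). -/
abbrev User (a : ℝ) (K : ℕ) : Type := Torus a × Torus a × BandClass K

namespace User

variable {a : ℝ} {K : ℕ}

/-- Location of the receiver. -/
def receiver (u : User a K) : Torus a := u.1

/-- Location of the transmitter. -/
def transmitter (u : User a K) : Torus a := u.2.1

/-- Class of the user. -/
def bands (u : User a K) : BandClass K := u.2.2

end User

/-- The σ-algebra on finite point configurations (finite counting measures) on `α`: a set of
configurations is measurable iff, for every `n`, the `n`-tuples of points whose configuration lies
in it form a measurable set of `Fin n → α`. -/
instance configMeasurableSpace (α : Type*) [MeasurableSpace α] : MeasurableSpace (Multiset α) :=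
  MeasurableSpace.map (fun s : Σ n : ℕ, (Fin n → α) => (List.ofFn s.2 : Multiset α)) inferInstance

/-- A configuration of the network: a finite multiset of users. -/
abbrev Config (a : ℝ) (K : ℕ) : Type := Multiset (User a K)

/-- Adding a user to a given configuration is a measurable operation. -/
theorem measurable_cons {α : Type*} [MeasurableSpace α] (Φ : Multiset α) :
    Measurable (fun u : α => u ::ₘ Φ) := by
  obtain ⟨l, rfl⟩ := Quotient.exists_rep Φ
  have h1 : Measurable (fun s : Σ n : ℕ, (Fin n → α) => (List.ofFn s.2 : Multiset α)) :=
    fun _ hs => hs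
  have h2 : Measurable (fun u : α =>
      (⟨l.length + 1, Fin.cons u l.get⟩ : Σ n : ℕ, (Fin n → α))) := by
    have h3 : Measurable (fun u : α => (Fin.cons u l.get : Fin (l.length + 1) → α)) := by
      refine measurable_pi_lambda _ fun i => ?_
      refine Fin.cases ?_ (fun j => ?_) i
      · exact measurable_id
      · simp
    have h5 : Measurable (fun f : Fin (l.length + 1) → α =>
        (⟨l.length + 1, f⟩ : Σ n : ℕ, (Fin n → α))) :=
      fun s hs => MeasurableSpace.measurableSet_iInf.1 hs (l.length + 1)
    exact h5.comp h3
  have h4 : (fun u : α => u ::ₘ (Quotient.mk _ l : Multiset α)) =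
      (fun s : Σ n : ℕ, (Fin n → α) => (List.ofFn s.2 : Multiset α)) ∘
        (fun u : α => (⟨l.length + 1, Fin.cons u l.get⟩ : Σ n : ℕ, (Fin n → α))) := by
    funext u
    simp only [Function.comp, List.ofFn_cons, List.ofFn_get]
    rfl
  rw [h4]
  exact h1.comp h2

/-- The parameters of a network with `K` bands. -/
structure Network (K : ℕ) where
  /-- space-time intensity of the Poisson rain of arrivals -/
  lam : ℝ
  /-- distance between the receiver and the transmitter of a user -/
  r : ℝ
  /-- thermal noise power -/
  noise : ℝ
  /-- path-loss function; only its values at non-negative distances matter -/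
  pathLoss : ℝ → ℝ
  /-- probability that an arriving user has a given class -/
  p : BandClass K → ℝ
  /-- mean file size of the users of a given class -/
  L : BandClass K → ℝ
  lam_pos : 0 < lam
  r_nonneg : 0 ≤ r
  noise_pos : 0 < noise
  pathLoss_nonneg : ∀ d, 0 ≤ d → 0 ≤ pathLoss d
  pathLoss_antitone : AntitoneOn pathLoss (Ici 0)
  pathLoss_zero : pathLoss 0 = 1
  p_nonneg : ∀ C, 0 ≤ p C
  p_sum : ∑ C, p C = 1
  L_pos : ∀ C, 0 < L C

namespace Network

variable {K : ℕ} (N : Network K) {a : ℝ}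

/-- The network is symmetric: users whose classes have the same cardinality have the same arrival
probability and the same file size distribution. -/
def IsSymmetric : Prop :=
  ∀ C D : BandClass K, C.1.card = D.1.card → N.p C = N.p D ∧ N.L C = N.L D

/-- Interference at the receiver of `u` created by the transmitters of the users in `Ψ`. -/
def interference (u : User a K) (Ψ : Config a K) : ℝ :=
  (Ψ.map fun z => ((u.bands.1 ∩ z.bands.1).card : ℝ) *
    N.pathLoss (torusDist u.receiver z.transmitter)).sum

open Classical in
/-- Rate of transmission of a user `u` of the configuration `Φ`; the user's own transmitter is
removed from the interference. -/
def rate (u : User a K) (Φ : Config a K) : ℝ :=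
  (u.bands.1.card : ℝ) * N.pathLoss N.r / (N.noise + N.interference u (Φ.erase u))

/-- Instantaneous departure rate of a user `u` of the configuration `Φ`: the file sizes in class
`C` are exponential with mean `L C`. -/
def deathRate (u : User a K) (Φ : Config a K) : ℝ :=
  N.rate u Φ / N.L u.bands

/-- The user of class `C` with transmitter at `y` and receiver at distance `N.r` from `y` in the
direction `θ`. -/
def dipole (C : BandClass K) (y : Torus a) (θ : ℝ) : User a K :=
  (y + (((N.r * Real.cos θ : ℝ) : AddCircle a), ((N.r * Real.sin θ : ℝ) : AddCircle a)), y, C)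

/-- The dipole depends measurably on the location of the transmitter and the direction. -/
theorem measurable_dipole (C : BandClass K) :
    Measurable (fun q : Torus a × ℝ => N.dipole C q.1 q.2) := by
  have hc : Measurable (fun x : ℝ => (x : AddCircle a)) :=
    (AddCircle.continuous_mk' a).measurable
  have h1 : Measurable (fun q : Torus a × ℝ => ((N.r * Real.cos q.2 : ℝ) : AddCircle a)) :=
    hc.comp (by fun_prop)
  have h2 : Measurable (fun q : Torus a × ℝ => ((N.r * Real.sin q.2 : ℝ) : AddCircle a)) :=
    hc.comp (by fun_prop)
  exact (measurable_fst.add (h1.prodMk h2)).prodMk (measurable_fst.prodMk measurable_const)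

variable [Fact (0 < a)]

/-- Arrival rates of users: the transmitter has intensity `λ dy`, the direction of the receiver is
uniform on the circle, the class has law `p`, all independent. -/
def arrivals : Measure (User a K) :=
  ∑ C : BandClass K, ENNReal.ofReal (N.lam * N.p C) •
    ((volume : Measure (Torus a)).prod
      ((ENNReal.ofReal (2 * Real.pi))⁻¹ • volume.restrict (Ioc 0 (2 * Real.pi)))).map
        (fun q : Torus a × ℝ => N.dipole C q.1 q.2)

open Classical in
/-- Jump rates of the spatial birth-and-death process: arrivals, and departures of the present
users `u` at rate `deathRate u Φ`. -/
def jumpRate (Φ : Config a K) : Measure (Config a K) :=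
  (N.arrivals (a := a)).map (fun u => u ::ₘ Φ) +
    (Φ.map fun u => ENNReal.ofReal (N.deathRate u Φ) • Measure.dirac (Φ.erase u)).sum

/-- `transitionAux n t Φ A` is the probability that the jump process with rates `jumpRate`,
started from `Φ`, makes fewer than `n` jumps up to time `t` and lies in `A` at time `t`
(decomposition at the first jump, which happens at rate `jumpRate Φ univ`). -/
def transitionAux : ℕ → ℝ → Config a K → Set (Config a K) → ℝ≥0∞
  | 0, _, _, _ => 0
  | n + 1, t, Φ, A =>
      ENNReal.ofReal (Real.exp (-((N.jumpRate Φ).real univ * t))) * A.indicator 1 Φ +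
        ∫⁻ s in Ioc 0 t, ENNReal.ofReal (Real.exp (-((N.jumpRate Φ).real univ * s))) *
          ∫⁻ Ψ, transitionAux n (t - s) Ψ A ∂(N.jumpRate Φ)

/-- Transition function `P_t(Φ, A)` of the Markov jump process with rates `jumpRate`. -/
def transition (t : ℝ) (Φ : Config a K) (A : Set (Config a K)) : ℝ≥0∞ :=
  ⨆ n : ℕ, N.transitionAux n t Φ A

/-- `π` is the law of the network in a stationary regime: a probability measure on configurations
that is invariant under the Markov jump process. -/
def IsStationary (π : Measure (Config a K)) : Prop :=
  IsProbabilityMeasure π ∧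
    ∀ t : ℝ, 0 ≤ t → ∀ A : Set (Config a K), MeasurableSet A →
      ∫⁻ Φ, N.transition t Φ A ∂π = π A

end Network

/-- User density of class `C` under the law `π`: the expected number of users of class `C` divided
by the area of the torus. -/
def userDensity {K : ℕ} {a : ℝ} [Fact (0 < a)] (π : Measure (Config a K)) (C : BandClass K) :
    ℝ≥0∞ :=
  (∫⁻ Φ : Config a K, (Multiset.card (Φ.filter fun u => u.bands = C) : ℝ≥0∞) ∂π) /
    volume (univ : Set (Torus a))

end WirelessSBD

end

/-! Choose a permutation of the bands carrying `C` to `D`. It acts on users by relabelling classes.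
Rates see bands only through cardinalities of classes and of their intersections, and symmetry
equates the arrival probabilities and mean file sizes, so the dynamics commute with the relabelling.
The image of a stationary law is therefore stationary (`IsStationary.map_permUser`), and it remains
to show that the stationary law is unique.

If `ℓ(r) > 0`, the network can empty within unit time from every configuration, with probability
bounded below in terms of the number of users (`exists_le_transitionAux`). All transition laws thus
charge a common point, which forces uniqueness by a Hahn decomposition argument (`eq_of_invariant`).
If `ℓ(r) = 0`, nobody ever leaves and no stationary law exists (`IsStationary.pathLoss_pos`). -/

namespace WirelessSBD

/-! ### Uniqueness of invariant probability measures -/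

section Measures

variable {X Y : Type*} [MeasurableSpace X] [MeasurableSpace Y]

theorem multiset_sum_measure_apply {ι : Type*} (s : Multiset ι) (m : ι → Measure X) (A : Set X) :
    (s.map m).sum A = (s.map fun i => m i A).sum := by
  induction s using Multiset.induction_on with
  | empty => simp
  | cons i s ih => simp [ih]

theorem map_multiset_sum_measure {ι : Type*} (s : Multiset ι) (m : ι → Measure X) {f : X → Y}
    (hf : Measurable f) :
    (s.map m).sum.map f = (s.map fun i => (m i).map f).sum := by
  induction s using Multiset.induction_on with
  | empty => simp
  | cons i s ih => simp [ih, Measure.map_add _ _ hf]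

/-- The integrand `f` need not be measurable: only the measurable lower bound `g` matters. -/
theorem eq_of_lintegral_eq_of_le_on_compl {μ ν : Measure X} [IsProbabilityMeasure μ]
    [IsProbabilityMeasure ν] {s : Set X} (hs : MeasurableSet s)
    (h₁ : ν.restrict s ≤ μ.restrict s) (h₂ : μ.restrict sᶜ ≤ ν.restrict sᶜ)
    {f g : X → ℝ≥0∞} (hf : ∀ x, f x ≤ 1) (hg : Measurable g) (hg0 : ∀ x, g x ≠ 0)
    (hgf : ∀ x, g x ≤ f x) (hμ : ∫⁻ x, f x ∂μ = μ s) (hν : ∫⁻ x, f x ∂ν = ν s) : μ = ν := by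
  -- The positive and negative parts of `μ - ν`. Subtracting the two integral identities gives `δ
  -- univ = ∫ f dδ - ∫ f dε`. Since `f ≤ 1`, this forces `∫ f dε = 0`, and `f ≥ g > 0` then gives `ε
  -- = 0`.
  set δ := μ.restrict s - ν.restrict s
  set ε := ν.restrict sᶜ - μ.restrict sᶜ
  have hδ : δ + ν.restrict s = μ.restrict s := Measure.sub_add_cancel_of_le h₁
  have hε : ε + μ.restrict sᶜ = ν.restrict sᶜ := Measure.sub_add_cancel_of_le h₂
  have e₁ : μ s = δ univ + ν s := by
    have := congrArg (fun m : Measure X => m univ) hδ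
    simpa using this.symm
  have hδ1 : ∫⁻ x, f x ∂δ ≤ δ univ := (lintegral_mono hf).trans (by simp)
  rw [← lintegral_add_compl f hs, ← hδ, lintegral_add_measure, e₁, ← hν,
    ← lintegral_add_compl (μ := ν) f hs, ← hε, lintegral_add_measure] at hμ
  have hfin : ∀ m : Measure X, IsFiniteMeasure m → ∫⁻ x, f x ∂m ≠ ∞ := fun m _ =>
    ((lintegral_mono hf).trans_lt (by simp [measure_lt_top])).ne
  have a₁ := hfin δ inferInstance
  have a₂ := hfin (ν.restrict s) inferInstance
  have a₃ := hfin (μ.restrict sᶜ) inferInstance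
  have a₄ := hfin ε inferInstance
  have a₅ : δ univ ≠ ∞ := measure_ne_top _ _
  have hε0 : ∫⁻ x, f x ∂ε = 0 := by
    lift ∫⁻ x, f x ∂δ to NNReal using a₁ with d
    lift ∫⁻ x, f x ∂ν.restrict s to NNReal using a₂ with b
    lift ∫⁻ x, f x ∂μ.restrict sᶜ to NNReal using a₃ with c
    lift ∫⁻ x, f x ∂ε to NNReal using a₄ with e
    lift δ univ to NNReal using a₅ with k
    norm_cast at hμ hδ1 ⊢
    have h1 : (d : ℝ) + b + c = k + (b + (e + c)) := by exact_mod_cast hμ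
    have h2 : (d : ℝ) ≤ k := by exact_mod_cast hδ1
    have h3 : (0 : ℝ) ≤ e := e.2
    have : (e : ℝ) = 0 := by linarith
    exact_mod_cast this
  have hεg : ∫⁻ x, g x ∂ε = 0 := le_antisymm ((lintegral_mono hgf).trans hε0.le) zero_le
  have hε00 : ε = 0 := by
    rw [lintegral_eq_zero_iff hg] at hεg
    rw [← ae_eq_bot, ← Filter.eventually_false_iff_eq_bot]
    filter_upwards [hεg] with x hx using hg0 x hx
  rw [hε00, zero_add] at hε
  -- With `ε = 0` the measures agree off `s`, so `ν ≤ μ` everywhere; equal total mass does the rest.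
  have hle : ν ≤ μ := by
    rw [← Measure.restrict_add_restrict_compl (μ := ν) hs,
      ← Measure.restrict_add_restrict_compl (μ := μ) hs, hε]
    gcongr
  exact (Measure.eq_of_le_of_isProbabilityMeasure hle).symm

/-- A family of sub-probabilities that charges a point from everywhere has at most one invariant
probability measure. -/
theorem eq_of_invariant {κ : X → Set X → ℝ≥0∞} (hκ : ∀ x s, κ x s ≤ 1) (x₀ : X)
    {g : X → ℝ≥0∞} (hg : Measurable g) (hg0 : ∀ x, g x ≠ 0)
    (hgκ : ∀ x s, x₀ ∈ s → g x ≤ κ x s) {μ ν : Measure X} [IsProbabilityMeasure μ]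
    [IsProbabilityMeasure ν] (hμ : ∀ s, MeasurableSet s → ∫⁻ x, κ x s ∂μ = μ s)
    (hν : ∀ s, MeasurableSet s → ∫⁻ x, κ x s ∂ν = ν s) : μ = ν := by
  -- The point `x₀` lies in one of the two Hahn sets, and `κ · s` for that set is bounded below by
  -- `g`. The two cases exchange `μ` and `ν`.
  obtain ⟨s, hs, h₁, h₂⟩ := exists_isHahnDecomposition ν μ
  by_cases hx : x₀ ∈ s
  · exact eq_of_lintegral_eq_of_le_on_compl hs h₁ h₂ (fun x => hκ x s) hg hg0
      (fun x => hgκ x s hx) (hμ s hs) (hν s hs)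
  · exact (eq_of_lintegral_eq_of_le_on_compl hs.compl h₂ (by rwa [compl_compl])
      (fun x => hκ x sᶜ) hg hg0 (fun x => hgκ x sᶜ hx) (hν _ hs.compl) (hμ _ hs.compl)).symm

/-- The probability that an exponential clock of rate `q` rings before `t`; it bounds the first-jump
term of `transitionAux`. -/
theorem lintegral_exp_neg_mul {q t : ℝ} (hq : 0 ≤ q) (ht : 0 ≤ t) :
    ∫⁻ s in Ioc 0 t, ENNReal.ofReal (Real.exp (-(q * s))) * ENNReal.ofReal q =
      ENNReal.ofReal (1 - Real.exp (-(q * t))) := by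
  have hint : ∫ s in (0 : ℝ)..t, Real.exp (-(q * s)) * q = 1 - Real.exp (-(q * t)) := by
    rw [intervalIntegral.integral_eq_sub_of_hasDerivAt
      (f := fun s => - Real.exp (-(q * s)))]
    · simp; ring
    · intro x _
      have := ((((hasDerivAt_id x).const_mul q).neg).exp).neg
      simp only [id_eq, mul_one, mul_neg, neg_neg] at this
      exact this
    · exact (by fun_prop : Continuous fun s : ℝ => Real.exp (-(q * s)) * q).intervalIntegrable _ _
  rw [← hint, intervalIntegral.integral_of_le ht, ofReal_integral_eq_lintegral_ofReal]
  · exact lintegral_congr fun s => (ENNReal.ofReal_mul (Real.exp_pos _).le).symm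
  · exact (by fun_prop : Continuous fun s : ℝ => Real.exp (-(q * s)) * q).integrableOn_Ioc
  · exact Filter.Eventually.of_forall fun s => by positivity

end Measures

/-! ### Measurability on finite configurations -/

section Configurations

variable {α β : Type*} [MeasurableSpace α] [MeasurableSpace β]

theorem measurable_multiset_ofFn :
    Measurable fun s : Σ n : ℕ, (Fin n → α) => (List.ofFn s.2 : Multiset α) :=
  fun _ hs => hs

theorem measurable_of_measurable_ofFn {f : Multiset α → β}
    (hf : ∀ n, Measurable fun x : Fin n → α => f (List.ofFn x : Multiset α)) : Measurable f :=
  fun _ hA => MeasurableSpace.measurableSet_iInf.2 fun n => hf n hA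

theorem measurable_multiset_map {f : α → β} (hf : Measurable f) :
    Measurable fun Φ : Multiset α => Φ.map f := by
  refine measurable_of_measurable_ofFn fun n => ?_
  have h₁ : Measurable fun x : Fin n → β => (⟨n, x⟩ : Σ n : ℕ, (Fin n → β)) :=
    fun s hs => MeasurableSpace.measurableSet_iInf.1 hs n
  have h₂ : Measurable fun x : Fin n → α => f ∘ x :=
    measurable_pi_lambda _ fun i => hf.comp (measurable_pi_apply i)
  have h₃ := (measurable_multiset_ofFn (α := β)).comp (h₁.comp h₂)
  convert h₃ using 2 with x
  simp [List.map_ofFn]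

theorem measurable_multiset_card : Measurable fun Φ : Multiset α => Multiset.card Φ :=
  measurable_of_measurable_ofFn fun n => by simp

theorem measurableSet_card_eq (n : ℕ) : MeasurableSet {Φ : Multiset α | Multiset.card Φ = n} :=
  measurable_multiset_card (measurableSet_singleton n)

/-- The action on configurations of a measurable equivalence of the points. -/
def configEquiv (e : α ≃ᵐ β) : Multiset α ≃ᵐ Multiset β where
  toFun := Multiset.map e
  invFun := Multiset.map e.symm
  left_inv Φ := by simp
  right_inv Φ := by simp
  measurable_toFun := measurable_multiset_map e.measurable
  measurable_invFun := measurable_multiset_map e.symm.measurable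

@[simp]
theorem configEquiv_apply (e : α ≃ᵐ β) (Φ : Multiset α) : configEquiv e Φ = Φ.map e := rfl

end Configurations

end WirelessSBD

namespace WirelessSBD

/-! ### Equivariance under permutations of the bands -/

section BandSymmetry

variable {K : ℕ}

theorem exists_perm_map_eq {C D : Finset (Fin K)} (h : C.card = D.card) :
    ∃ σ : Equiv.Perm (Fin K), C.map σ.toEmbedding = D := by
  -- A bijection between subsets of a finite set extends to a permutation, the complements being
  -- equinumerous.
  let e : {x // x ∈ C} ≃ {x // x ∈ D} := Finset.equivOfCardEq h
  refine ⟨e.extendSubtype, Finset.eq_of_subset_of_card_le (fun x hx => ?_) (by simp [h])⟩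
  obtain ⟨y, hy, rfl⟩ := Finset.mem_map.1 hx
  exact e.extendSubtype_mem y hy

/-- The permutation of the classes induced by a permutation of the bands. -/
def permClass (σ : Equiv.Perm (Fin K)) : Equiv.Perm (BandClass K) where
  toFun C := ⟨C.1.map σ.toEmbedding, C.2.map⟩
  invFun C := ⟨C.1.map σ.symm.toEmbedding, C.2.map⟩
  left_inv C := by ext; simp
  right_inv C := by ext; simp

@[simp]
theorem coe_permClass (σ : Equiv.Perm (Fin K)) (C : BandClass K) :
    (permClass σ C).1 = C.1.map σ.toEmbedding := rfl

/-- A permutation of the bands acts on users through their classes. -/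
def permUser (a : ℝ) (σ : Equiv.Perm (Fin K)) : User a K ≃ᵐ User a K where
  toFun u := (u.1, u.2.1, permClass σ u.2.2)
  invFun u := (u.1, u.2.1, (permClass σ).symm u.2.2)
  left_inv u := by simp
  right_inv u := by simp
  measurable_toFun := measurable_fst.prodMk ((measurable_fst.comp measurable_snd).prodMk
    ((measurable_from_top (f := permClass σ)).comp (measurable_snd.comp measurable_snd)))
  measurable_invFun := measurable_fst.prodMk ((measurable_fst.comp measurable_snd).prodMk
    ((measurable_from_top (f := (permClass σ).symm)).comp (measurable_snd.comp measurable_snd)))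

variable {a : ℝ} (σ : Equiv.Perm (Fin K))

@[simp]
theorem receiver_permUser (u : User a K) : (permUser a σ u).receiver = u.receiver := rfl

@[simp]
theorem transmitter_permUser (u : User a K) : (permUser a σ u).transmitter = u.transmitter := rfl

@[simp]
theorem bands_permUser (u : User a K) : (permUser a σ u).bands = permClass σ u.bands := rfl

namespace Network

variable (N : Network K)

theorem interference_permUser (u : User a K) (Ψ : Config a K) :
    N.interference (permUser a σ u) (Ψ.map (permUser a σ)) = N.interference u Ψ := by
  simp [interference, Multiset.map_map, Function.comp_def, ← Finset.map_inter]

theorem rate_permUser (u : User a K) (Φ : Config a K) :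
    N.rate (permUser a σ u) (Φ.map (permUser a σ)) = N.rate u Φ := by
  classical
  unfold rate
  rw [← Multiset.map_erase _ (permUser a σ).injective, interference_permUser]
  simp

variable {N}

theorem deathRate_permUser (hN : N.IsSymmetric) (u : User a K) (Φ : Config a K) :
    N.deathRate (permUser a σ u) (Φ.map (permUser a σ)) = N.deathRate u Φ := by
  rw [deathRate, rate_permUser, deathRate, bands_permUser,
    (hN (permClass σ u.bands) u.bands (by simp)).2]

variable [Fact (0 < a)]

/-- The relabelling leaves the locations of a dipole alone, so it only permutes the summands over
classes, whose weights agree by symmetry. -/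
theorem map_permUser_arrivals (hN : N.IsSymmetric) :
    (N.arrivals (a := a)).map (permUser a σ) = N.arrivals := by
  have hm := (permUser a σ).measurable
  rw [arrivals, ← Measure.mapₗ_apply_of_measurable hm, map_sum]
  refine Fintype.sum_equiv (permClass σ) _ _ fun C => ?_
  rw [_root_.map_smul, Measure.mapₗ_apply_of_measurable hm,
    Measure.map_map hm (N.measurable_dipole C), (hN (permClass σ C) C (by simp)).1]
  rfl

theorem jumpRate_map_permUser (hN : N.IsSymmetric) (Φ : Config a K) :
    N.jumpRate (Φ.map (permUser a σ)) = (N.jumpRate Φ).map (configEquiv (permUser a σ)) := by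
  classical
  have hm := (permUser a σ).measurable
  have hM := (configEquiv (permUser a σ)).measurable
  unfold jumpRate
  rw [Measure.map_add _ _ hM, map_multiset_sum_measure _ _ hM, Multiset.map_map,
    Measure.map_map hM (measurable_cons Φ)]
  congr 1
  · conv_lhs => rw [← map_permUser_arrivals σ hN, Measure.map_map (measurable_cons _) hm]
    congr 1
    funext u
    simp
  · congr 1
    refine Multiset.map_congr rfl fun u _ => ?_
    rw [Function.comp_apply, deathRate_permUser σ hN, Measure.map_smul, Measure.map_dirac' hM,
      ← Multiset.map_erase _ (permUser a σ).injective]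
    rfl

theorem transitionAux_map_permUser (hN : N.IsSymmetric) (n : ℕ) (t : ℝ) (Φ : Config a K)
    (A : Set (Config a K)) :
    N.transitionAux n t (Φ.map (permUser a σ)) A =
      N.transitionAux n t Φ (configEquiv (permUser a σ) ⁻¹' A) := by
  induction n generalizing t Φ with
  | zero => rfl
  | succ n ih =>
    have hM := (configEquiv (permUser a σ)).measurable
    have hq : (N.jumpRate (Φ.map (permUser a σ))).real univ = (N.jumpRate Φ).real univ := by
      rw [jumpRate_map_permUser σ hN, map_measureReal_apply hM MeasurableSet.univ, preimage_univ]
    rw [transitionAux, transitionAux, hq]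
    congr 1
    refine lintegral_congr fun s => ?_
    -- For a measurable equivalence the change of variables needs no measurability of the integrand,
    -- which is not established for `transitionAux`.
    rw [jumpRate_map_permUser σ hN, lintegral_map_equiv]
    simp only [configEquiv_apply, ih]

theorem IsStationary.map_permUser (hN : N.IsSymmetric) {π : Measure (Config a K)}
    (hπ : N.IsStationary π) : N.IsStationary (π.map (configEquiv (permUser a σ))) := by
  have := hπ.1
  have hM := (configEquiv (permUser a σ)).measurable
  refine ⟨Measure.isProbabilityMeasure_map hM.aemeasurable, fun t ht A hA => ?_⟩
  rw [lintegral_map_equiv, Measure.map_apply hM hA, ← hπ.2 t ht _ (hM hA)]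
  simp only [transition, configEquiv_apply, transitionAux_map_permUser σ hN]

end Network

theorem userDensity_map_permUser [Fact (0 < a)] (π : Measure (Config a K)) (C : BandClass K) :
    userDensity (π.map (configEquiv (permUser a σ))) (permClass σ C) = userDensity π C := by
  unfold userDensity
  rw [lintegral_map_equiv]
  congr 1
  refine lintegral_congr fun Φ => ?_
  rw [configEquiv_apply, Multiset.filter_map, Multiset.card_map]
  simp [Function.comp_def]

end BandSymmetry

end WirelessSBD

namespace WirelessSBD

/-! ### Bounds on the jump rates -/

section Rates

variable {a : ℝ} {K : ℕ}

theorem torusDist_nonneg (x y : Torus a) : 0 ≤ torusDist x y := Real.sqrt_nonneg _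

namespace Network

variable (N : Network K)

theorem pathLoss_le_one {d : ℝ} (hd : 0 ≤ d) : N.pathLoss d ≤ 1 :=
  N.pathLoss_zero ▸ N.pathLoss_antitone (mem_Ici.2 le_rfl) (mem_Ici.2 hd) hd

theorem interference_nonneg (u : User a K) (Ψ : Config a K) : 0 ≤ N.interference u Ψ := by
  refine Multiset.sum_nonneg fun x hx => ?_
  obtain ⟨z, -, rfl⟩ := Multiset.mem_map.1 hx
  exact mul_nonneg (Nat.cast_nonneg _) (N.pathLoss_nonneg _ (torusDist_nonneg _ _))

theorem interference_le (u : User a K) (Ψ : Config a K) :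
    N.interference u Ψ ≤ Multiset.card Ψ * K := by
  have h := Multiset.sum_le_card_nsmul (Ψ.map fun z => ((u.bands.1 ∩ z.bands.1).card : ℝ) *
    N.pathLoss (torusDist u.receiver z.transmitter)) K fun x hx => by
      obtain ⟨z, -, rfl⟩ := Multiset.mem_map.1 hx
      have h₁ : ((u.bands.1 ∩ z.bands.1).card : ℝ) ≤ K := by
        exact_mod_cast (Finset.card_le_univ _).trans (Fintype.card_fin K).le
      have h₂ := N.pathLoss_le_one (torusDist_nonneg u.receiver z.transmitter)
      have h₃ := N.pathLoss_nonneg _ (torusDist_nonneg u.receiver z.transmitter)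
      calc _ ≤ (K : ℝ) * 1 := by gcongr
        _ = K := mul_one _
  rwa [Multiset.card_map, nsmul_eq_mul] at h

theorem deathRate_le (u : User a K) (Φ : Config a K) :
    N.deathRate u Φ ≤ ∑ C : BandClass K, (C.1.card : ℝ) * N.pathLoss N.r / N.noise / N.L C := by
  have h₁ := N.pathLoss_nonneg _ N.r_nonneg
  have h₂ := N.noise_pos
  have h₃ := N.L_pos
  refine le_trans ?_ (Finset.single_le_sum (fun C _ => ?_) (Finset.mem_univ u.bands))
  · unfold deathRate rate
    gcongr
    · exact (h₃ _).le
    · exact le_add_of_nonneg_right (N.interference_nonneg _ _)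
  · have := h₃ C
    positivity

theorem sum_L_pos : 0 < ∑ C, N.L C := by
  rcases isEmpty_or_nonempty (BandClass K) with h | h
  -- Without classes, the probabilities would sum to `0` rather than `1`.
  · simpa using N.p_sum
  · exact Finset.sum_pos (fun C _ => N.L_pos C) Finset.univ_nonempty

/-- A class has at least one band, and each of the `n` other users contributes at most `K` to the
interference. The sum of all `L C` serves as a class-independent bound on the mean file size. -/
theorem le_deathRate {u : User a K} {Φ : Config a K} {n : ℕ} (hu : u ∈ Φ)
    (hΦ : Multiset.card Φ = n + 1) :
    N.pathLoss N.r / (N.noise + n * K) / ∑ C, N.L C ≤ N.deathRate u Φ := by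
  classical
  have h₁ := N.pathLoss_nonneg _ N.r_nonneg
  have h₂ := N.noise_pos
  have h₃ : N.L u.bands ≤ ∑ C, N.L C :=
    Finset.single_le_sum (fun C _ => (N.L_pos C).le) (Finset.mem_univ u.bands)
  have h₄ := N.L_pos u.bands
  have h₅ : (1 : ℝ) ≤ u.bands.1.card := by exact_mod_cast u.bands.2.card_pos
  unfold deathRate rate
  have h₆ := N.interference_le u (Φ.erase u)
  rw [Multiset.card_erase_of_mem hu, hΦ, Nat.pred_succ] at h₆
  have h₇ := N.interference_nonneg u (Φ.erase u)
  calc _ = 1 * N.pathLoss N.r / (N.noise + n * K) / ∑ C, N.L C := by rw [one_mul]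
    _ ≤ u.bands.1.card * N.pathLoss N.r / (N.noise + n * K) / N.L u.bands := by gcongr
    _ ≤ u.bands.1.card * N.pathLoss N.r / (N.noise + N.interference u (Φ.erase u)) /
        N.L u.bands := by gcongr
    _ = _ := by congr!

variable [Fact (0 < a)]

theorem arrivals_univ :
    N.arrivals (univ : Set (User a K)) =
      ENNReal.ofReal N.lam * volume (univ : Set (Torus a)) := by
  have h2π : ENNReal.ofReal (2 * Real.pi) ≠ 0 := by simp [Real.pi_pos]
  simp only [arrivals, Measure.coe_finsetSum, Finset.sum_apply, Measure.smul_apply, smul_eq_mul]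
  have h (C : BandClass K) : (((volume : Measure (Torus a)).prod
      ((ENNReal.ofReal (2 * Real.pi))⁻¹ • volume.restrict (Ioc 0 (2 * Real.pi)))).map
        (fun q : Torus a × ℝ => N.dipole C q.1 q.2)) univ = volume (univ : Set (Torus a)) := by
    rw [Measure.map_apply (N.measurable_dipole C) MeasurableSet.univ, preimage_univ,
      ← univ_prod_univ, Measure.prod_prod]
    rw [Measure.smul_apply, Measure.restrict_apply_univ, Real.volume_Ioc, sub_zero, smul_eq_mul,
      ENNReal.inv_mul_cancel h2π ENNReal.ofReal_ne_top, mul_one]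
  simp only [h]
  rw [← Finset.sum_mul, ← ENNReal.ofReal_sum_of_nonneg fun C _ =>
    mul_nonneg N.lam_pos.le (N.p_nonneg C), ← Finset.mul_sum, N.p_sum, mul_one]

instance : IsFiniteMeasure (N.arrivals (a := a)) :=
  ⟨by rw [arrivals_univ]; exact ENNReal.mul_lt_top ENNReal.ofReal_lt_top (measure_lt_top _ _)⟩

theorem arrivals_real_univ_pos : 0 < (N.arrivals (a := a)).real univ := by
  have hv : volume (univ : Set (Torus a)) ≠ 0 := by
    rw [Measure.measure_univ_ne_zero]
    exact NeZero.ne _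
  rw [measureReal_def, arrivals_univ]
  refine ENNReal.toReal_pos (mul_ne_zero ?_ hv)
    (ENNReal.mul_ne_top ENNReal.ofReal_ne_top (measure_ne_top _ _))
  simpa using N.lam_pos

open Classical in
theorem jumpRate_apply (Φ : Config a K) (A : Set (Config a K)) :
    N.jumpRate Φ A = (N.arrivals (a := a)).map (fun u => u ::ₘ Φ) A +
      (Φ.map fun u => ENNReal.ofReal (N.deathRate u Φ) *
        (Measure.dirac (Φ.erase u) : Measure (Config a K)) A).sum := by
  rw [jumpRate, Measure.add_apply, multiset_sum_measure_apply]
  simp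

theorem jumpRate_univ_le (Φ : Config a K) :
    N.jumpRate Φ univ ≤ N.arrivals (univ : Set (User a K)) + Multiset.card Φ *
      ENNReal.ofReal (∑ C : BandClass K, (C.1.card : ℝ) * N.pathLoss N.r / N.noise / N.L C) := by
  classical
  rw [jumpRate_apply, Measure.map_apply (measurable_cons Φ) MeasurableSet.univ, preimage_univ]
  gcongr
  refine (Multiset.sum_le_card_nsmul _ _ fun x hx => ?_).trans
    (by rw [Multiset.card_map, nsmul_eq_mul])
  obtain ⟨u, -, rfl⟩ := Multiset.mem_map.1 hx
  rw [measure_univ, mul_one]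
  exact ENNReal.ofReal_le_ofReal (N.deathRate_le u Φ)

instance (Φ : Config a K) : IsFiniteMeasure (N.jumpRate Φ) :=
  ⟨(N.jumpRate_univ_le Φ).trans_lt (ENNReal.add_lt_top.2 ⟨measure_lt_top _ _,
    ENNReal.mul_lt_top (ENNReal.natCast_lt_top _) ENNReal.ofReal_lt_top⟩)⟩

theorem exists_jumpRate_real_univ_le (a : ℝ) [Fact (0 < a)] (n : ℕ) :
    ∃ Q : ℝ, ∀ Φ : Config a K, Multiset.card Φ = n → (N.jumpRate Φ).real univ ≤ Q := by
  refine ⟨(N.arrivals (univ : Set (User a K)) + n * ENNReal.ofReal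
    (∑ C : BandClass K, (C.1.card : ℝ) * N.pathLoss N.r / N.noise / N.L C)).toReal, ?_⟩
  rintro Φ rfl
  exact ENNReal.toReal_mono (ENNReal.add_ne_top.2 ⟨measure_ne_top _ _,
    ENNReal.mul_ne_top (ENNReal.natCast_ne_top _) ENNReal.ofReal_ne_top⟩) (N.jumpRate_univ_le Φ)

theorem exists_le_jumpRate_card_eq (a : ℝ) [Fact (0 < a)] (h : 0 < N.pathLoss N.r) (n : ℕ) :
    ∃ c : ℝ≥0∞, c ≠ 0 ∧ ∀ Φ : Config a K, Multiset.card Φ = n + 1 →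
      c ≤ N.jumpRate Φ {Ψ | Multiset.card Ψ = n} := by
  classical
  have h₂ := N.noise_pos
  have h₃ := N.sum_L_pos
  refine ⟨ENNReal.ofReal (N.pathLoss N.r / (N.noise + n * K) / ∑ C, N.L C), ?_, fun Φ hΦ => ?_⟩
  · rw [Ne, ENNReal.ofReal_eq_zero, not_le]
    positivity
  · obtain ⟨u, hu⟩ := Multiset.card_pos_iff_exists_mem.1 (hΦ.symm ▸ n.succ_pos :
      0 < Multiset.card Φ)
    rw [jumpRate_apply]
    refine le_add_left ((ENNReal.ofReal_le_ofReal (N.le_deathRate hu hΦ)).trans ?_)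
    refine le_trans (le_of_eq ?_)
      (Multiset.single_le_sum (fun _ _ => zero_le) _ (Multiset.mem_map_of_mem _ hu))
    rw [Measure.dirac_apply' _ (measurableSet_card_eq n), indicator_of_mem, Pi.one_apply, mul_one]
    have := Multiset.card_erase_of_mem hu
    rwa [hΦ, Nat.pred_succ] at this

end Network

end Rates

end WirelessSBD

namespace WirelessSBD

/-! ### Emptying the network and uniqueness -/

section Transition

namespace Network

variable {a : ℝ} {K : ℕ} [Fact (0 < a)] (N : Network K)

theorem transitionAux_le_one (n : ℕ) {t : ℝ} (ht : 0 ≤ t) (Φ : Config a K)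
    (A : Set (Config a K)) : N.transitionAux n t Φ A ≤ 1 := by
  induction n generalizing t Φ with
  | zero => exact zero_le
  | succ n ih =>
    set q := (N.jumpRate Φ).real univ with hq
    have hq0 : 0 ≤ q := measureReal_nonneg
    have hqt : Real.exp (-(q * t)) ≤ 1 := Real.exp_le_one_iff.2 (by nlinarith)
    have hjump (s : ℝ) (hs : s ∈ Ioc 0 t) :
        ∫⁻ Ψ, N.transitionAux n (t - s) Ψ A ∂(N.jumpRate Φ) ≤ ENNReal.ofReal q := by
      refine (lintegral_mono fun Ψ => ih (sub_nonneg.2 hs.2) Ψ).trans ?_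
      rw [lintegral_one, hq, ofReal_measureReal]
    calc N.transitionAux (n + 1) t Φ A
        ≤ ENNReal.ofReal (Real.exp (-(q * t))) * 1 +
          ∫⁻ s in Ioc 0 t, ENNReal.ofReal (Real.exp (-(q * s))) * ENNReal.ofReal q := by
          rw [transitionAux]
          refine add_le_add (mul_le_mul_right (indicator_le_self' (fun _ _ => zero_le) _) _) ?_
          refine setLIntegral_mono' measurableSet_Ioc fun s hs => ?_
          exact mul_le_mul_right (hjump s hs) _
      _ = 1 := by
          rw [lintegral_exp_neg_mul hq0 ht, mul_one, ← ENNReal.ofReal_add (Real.exp_pos _).le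
            (sub_nonneg.2 hqt), add_sub_cancel, ENNReal.ofReal_one]

theorem transition_le_one {t : ℝ} (ht : 0 ≤ t) (Φ : Config a K) (A : Set (Config a K)) :
    N.transition t Φ A ≤ 1 :=
  iSup_le fun n => N.transitionAux_le_one n ht Φ A

/-- If users leave at a positive rate, the network empties with a positive probability, bounded
below in terms of the initial number of users. -/
theorem exists_le_transitionAux (h : 0 < N.pathLoss N.r) {A : Set (Config a K)} (hA : 0 ∈ A)
    (n : ℕ) {t₁ : ℝ} (ht₁ : 0 < t₁) (t₂ : ℝ) :
    ∃ c : ℝ≥0∞, c ≠ 0 ∧ ∀ t ∈ Icc t₁ t₂, ∀ Φ : Config a K, Multiset.card Φ = n →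
      c ≤ N.transitionAux (n + 1) t Φ A := by
  induction n generalizing t₁ with
  | zero =>
    obtain ⟨Q, hQ⟩ := N.exists_jumpRate_real_univ_le a 0
    refine ⟨ENNReal.ofReal (Real.exp (-(Q * t₂))), by simp [Real.exp_pos], fun t ht Φ hΦ => ?_⟩
    have hQt : (N.jumpRate Φ).real univ * t ≤ Q * t₂ :=
      mul_le_mul (hQ Φ hΦ) ht.2 (ht₁.le.trans ht.1) (measureReal_nonneg.trans (hQ Φ hΦ))
    obtain rfl := Multiset.card_eq_zero.1 hΦ
    rw [transitionAux, indicator_of_mem hA, Pi.one_apply, mul_one]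
    refine le_add_right (ENNReal.ofReal_le_ofReal ?_)
    gcongr
  | succ n ih =>
    obtain ⟨Q, hQ⟩ := N.exists_jumpRate_real_univ_le a (n + 1)
    obtain ⟨d, hd, hjump⟩ := N.exists_le_jumpRate_card_eq a h n
    obtain ⟨c, hc, hcle⟩ := ih (half_pos ht₁)
    -- Let the first jump be a departure before time `t₁ / 2`, of rate at least `d`. The remaining
    -- time lies in `[t₁ / 2, t₂]`, where the induction hypothesis supplies `c`.
    refine ⟨ENNReal.ofReal (Real.exp (-(Q * t₂))) * (c * d) * ENNReal.ofReal (t₁ / 2), ?_,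
      fun t ht Φ hΦ => ?_⟩
    · simp [Real.exp_pos, hc, hd, ht₁]
    have hinner (s : ℝ) (hs : s ∈ Ioc 0 (t₁ / 2)) :
        c * d ≤ ∫⁻ Ψ, N.transitionAux (n + 1) (t - s) Ψ A ∂(N.jumpRate Φ) := by
      calc c * d ≤ c * N.jumpRate Φ {Ψ | Multiset.card Ψ = n} :=
            mul_le_mul_right (hjump Φ hΦ) _
        _ = ∫⁻ Ψ, {Ψ | Multiset.card Ψ = n}.indicator (fun _ => c) Ψ ∂(N.jumpRate Φ) :=
            (lintegral_indicator_const (measurableSet_card_eq n) c).symm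
        _ ≤ _ := lintegral_mono fun Ψ => indicator_le' (fun Ψ hΨ => hcle (t - s)
            ⟨by linarith [hs.2, ht.1], by linarith [hs.1, ht.2]⟩ Ψ hΨ) (fun _ _ => zero_le) Ψ
    rw [transitionAux]
    refine le_add_left ?_
    calc _ = ∫⁻ _ in Ioc 0 (t₁ / 2), ENNReal.ofReal (Real.exp (-(Q * t₂))) * (c * d) := by
          rw [setLIntegral_const, Real.volume_Ioc, sub_zero]
      _ ≤ ∫⁻ s in Ioc 0 (t₁ / 2), ENNReal.ofReal (Real.exp (-((N.jumpRate Φ).real univ * s))) *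
          ∫⁻ Ψ, N.transitionAux (n + 1) (t - s) Ψ A ∂(N.jumpRate Φ) := by
          refine setLIntegral_mono' measurableSet_Ioc fun s hs =>
            mul_le_mul' (ENNReal.ofReal_le_ofReal ?_) (hinner s hs)
          have hQs : (N.jumpRate Φ).real univ * s ≤ Q * t₂ :=
            mul_le_mul (hQ Φ hΦ) (by linarith [hs.2, ht.1, ht.2]) hs.1.le
              (measureReal_nonneg.trans (hQ Φ hΦ))
          gcongr
      _ ≤ _ := lintegral_mono_set (Ioc_subset_Ioc_right (by linarith [ht.1]))

variable {N} in
-- The empty configuration is the point charged from everywhere. The lower bound depends only on the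
-- number of users, hence is measurable.
theorem IsStationary.eq_of_pathLoss_pos (h : 0 < N.pathLoss N.r) {π π' : Measure (Config a K)}
    (hπ : N.IsStationary π) (hπ' : N.IsStationary π') : π = π' := by
  have := hπ.1
  have := hπ'.1
  -- The constants are taken for `{0}` and extended by monotonicity, so that they do not depend on
  -- the target set.
  choose c hc hle using fun n =>
    N.exists_le_transitionAux (a := a) h (A := {0}) rfl n one_pos 1
  have hmono (n : ℕ) (t : ℝ) (Φ : Config a K) {A B : Set (Config a K)} (hAB : A ⊆ B) :
      N.transitionAux n t Φ A ≤ N.transitionAux n t Φ B := by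
    induction n generalizing t Φ with
    | zero => exact le_rfl
    | succ n ih =>
      rw [transitionAux, transitionAux]
      have hind : A.indicator (1 : Config a K → ℝ≥0∞) Φ ≤ B.indicator 1 Φ :=
        indicator_le_indicator_of_subset hAB (fun _ => zero_le) _
      gcongr
      exact ih _ _
  refine eq_of_invariant (κ := N.transition 1) (N.transition_le_one zero_le_one) 0
    (g := fun Φ => c (Multiset.card Φ)) (measurable_from_top.comp measurable_multiset_card)
    (fun Φ => hc _) (fun Φ A hA => ?_) (hπ.2 1 zero_le_one) (hπ'.2 1 zero_le_one)
  exact ((hle _ 1 ⟨le_rfl, le_rfl⟩ Φ rfl).trans (hmono _ _ _ (singleton_subset_iff.2 hA))).trans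
    (le_iSup (fun n => N.transitionAux n 1 Φ A) _)

/-! ### Absence of a stationary law without service -/

variable {N} in
theorem jumpRate_of_pathLoss_eq_zero (h : N.pathLoss N.r = 0) (Φ : Config a K) :
    N.jumpRate Φ = (N.arrivals (a := a)).map (fun u => u ::ₘ Φ) := by
  have hd (u : User a K) : N.deathRate u Φ = 0 := by simp [deathRate, rate, h]
  simp [jumpRate, hd]

variable {N} in
theorem lintegral_jumpRate_of_pathLoss_eq_zero (h : N.pathLoss N.r = 0) {m : ℕ}
    {f : Config a K → ℝ≥0∞} (hf : ∀ Ψ, m < Multiset.card Ψ → f Ψ = 0) {Φ : Config a K}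
    (hΦ : m ≤ Multiset.card Φ) : ∫⁻ Ψ, f Ψ ∂(N.jumpRate Φ) = 0 := by
  have hae : ∀ᵐ Ψ ∂(N.jumpRate Φ), f Ψ = 0 := by
    rw [jumpRate_of_pathLoss_eq_zero h]
    have hm : ∀ᵐ Ψ ∂(N.arrivals (a := a)).map (fun u => u ::ₘ Φ), m < Multiset.card Ψ := by
      refine (ae_map_iff (measurable_cons Φ).aemeasurable
        (measurable_multiset_card (measurableSet_Ioi (a := m)))).2 ?_
      exact Filter.Eventually.of_forall fun u =>
        hΦ.trans_lt (Multiset.card_lt_card (Multiset.lt_cons_self Φ u))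
    filter_upwards [hm] with Ψ hΨ using hf Ψ hΨ
  rw [lintegral_congr_ae hae, lintegral_zero]

variable {N} in
theorem transitionAux_card_eq_of_lt (h : N.pathLoss N.r = 0) {m : ℕ} (n : ℕ) (t : ℝ)
    (Φ : Config a K) (hΦ : m < Multiset.card Φ) :
    N.transitionAux n t Φ {Ψ | Multiset.card Ψ = m} = 0 := by
  induction n generalizing t Φ with
  | zero => rfl
  | succ n ih =>
    rw [transitionAux, indicator_of_notMem (by simpa using hΦ.ne'), mul_zero, zero_add]
    simp [lintegral_jumpRate_of_pathLoss_eq_zero h (fun Ψ hΨ => ih _ Ψ hΨ) hΦ.le]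

variable {N} in
-- Every jump adds a user, so having `m` users at time `t` requires starting with exactly `m` and
-- making no jump.
theorem transition_card_eq_le (h : N.pathLoss N.r = 0) {m : ℕ} (t : ℝ) (Φ : Config a K)
    (hΦ : m ≤ Multiset.card Φ) :
    N.transition t Φ {Ψ | Multiset.card Ψ = m} ≤ {Ψ | Multiset.card Ψ = m}.indicator
      (fun _ => ENNReal.ofReal (Real.exp (-((N.arrivals (a := a)).real univ * t)))) Φ := by
  have hq : (N.jumpRate Φ).real univ = (N.arrivals (a := a)).real univ := by
    rw [jumpRate_of_pathLoss_eq_zero h, map_measureReal_apply (measurable_cons Φ)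
      MeasurableSet.univ, preimage_univ]
  refine iSup_le fun n => ?_
  cases n with
  | zero => exact zero_le
  | succ n =>
    rw [transitionAux, hq]
    simp only [lintegral_jumpRate_of_pathLoss_eq_zero h
      (fun Ψ hΨ => transitionAux_card_eq_of_lt h n _ Ψ hΨ) hΦ, mul_zero, lintegral_zero, add_zero]
    by_cases hm : Multiset.card Φ = m <;> simp [indicator, hm]

variable {N} in
/-- Without service the number of users only grows, so that there is no stationary regime. -/
theorem IsStationary.pathLoss_pos {π : Measure (Config a K)} (hπ : N.IsStationary π) :
    0 < N.pathLoss N.r := by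
  have := hπ.1
  refine (N.pathLoss_nonneg _ N.r_nonneg).lt_of_ne' fun h => ?_
  have hnull (m : ℕ) : π {Φ | Multiset.card Φ = m} = 0 := by
    induction m using Nat.strong_induction_on with
    | _ m ih =>
      have hae : ∀ᵐ Φ ∂π, m ≤ Multiset.card Φ := by
        have : ∀ᵐ Φ ∂π, ∀ k : ℕ, k < m → Multiset.card Φ ≠ k := by
          refine ae_all_iff.2 fun k => ?_
          by_cases hk : k < m
          · have : ∀ᵐ Φ ∂π, Multiset.card Φ ≠ k := by simpa [ae_iff] using ih k hk
            filter_upwards [this] with Φ hΦ _ using hΦ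
          · exact Filter.Eventually.of_forall fun _ hk' => absurd hk' hk
        filter_upwards [this] with Φ hΦ
        by_contra! hlt
        exact hΦ _ hlt rfl
      -- Almost surely there are at least `m` users, so invariance at time `1` bounds this mass by
      -- itself times a factor less than `1`: it vanishes.
      have hle : π {Φ | Multiset.card Φ = m} ≤
          ENNReal.ofReal (Real.exp (-((N.arrivals (a := a)).real univ * 1))) *
            π {Φ | Multiset.card Φ = m} := by
        conv_lhs => rw [← hπ.2 1 zero_le_one _ (measurableSet_card_eq m)]
        rw [← lintegral_indicator_const (measurableSet_card_eq m)]
        refine lintegral_mono_ae ?_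
        filter_upwards [hae] with Φ hΦ using transition_card_eq_le h 1 Φ hΦ
      by_contra hne
      refine hle.not_gt ?_
      have hlt : ENNReal.ofReal (Real.exp (-((N.arrivals (a := a)).real univ * 1))) < 1 := by
        rw [ENNReal.ofReal_lt_one, Real.exp_lt_one_iff]
        linarith [N.arrivals_real_univ_pos (a := a)]
      calc _ < 1 * π {Φ | Multiset.card Φ = m} :=
            ENNReal.mul_lt_mul_left hne (measure_ne_top _ _) hlt
        _ = _ := one_mul _
  have huniv : (univ : Set (Config a K)) = ⋃ m : ℕ, {Φ | Multiset.card Φ = m} := by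
    ext; simp
  have := measure_iUnion_null hnull
  rw [← huniv, measure_univ] at this
  exact one_ne_zero this

end Network

end Transition

end WirelessSBD

theorem mainTheorem11 {K : ℕ} {a : ℝ} [Fact (0 < a)] (N : WirelessSBD.Network K)
    (hN : N.IsSymmetric) (π : MeasureTheory.Measure (WirelessSBD.Config a K))
    (hπ : N.IsStationary π) (C D : WirelessSBD.BandClass K) (hCD : C.1.card = D.1.card) :
    WirelessSBD.userDensity π C = WirelessSBD.userDensity π D := by
  obtain ⟨σ, hσ⟩ := WirelessSBD.exists_perm_map_eq hCD
  have hD : WirelessSBD.permClass σ C = D := Subtype.ext hσ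
  rw [← WirelessSBD.userDensity_map_permUser σ π C, hD,
    (hπ.map_permUser σ hN).eq_of_pathLoss_pos hπ.pathLoss_pos hπ]
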